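/- Let $H=(H_{m,n})_{m,n\in\mathbb{N}}$ be an infinite complex matrix (not necessarily Hermitian) that is banded, i.e. for some positive integer $B$ one has $H_{m,n}=0$ whenever $|m-n|>B$, and eventually periodic, i.e. for some period $p\ge 1$ and some $M_+\ge 0$ one has $H_{m,n}=H_{m+p,n+p}$ for all $m\ge M_+$ and all $n$. Such a matrix defines a bounded operator on $\ell^2(\mathbb{N})$, also denoted $H$; let $z\in\mathbb{C}\setminus\sigma(H)$. Let $N_d\ge 0$ be such that the rows of the matrix $z-H$ after the first $N_d$ rows form a matrix $(z-H)_{\mathrm{per}}$ consisting of one block $P\in\mathbb{C}^{p\times w}$ repeating periodically off to infinity: for some $c\ge 0$ and every $k\ge 0$, rows $kp+1,\dots,kp+p$ of $(z-H)_{\mathrm{per}}$ contain $P$ in columns $c+kp+1,\dots,c+kp+w$ and zeros elsewhere. Let $N_b\ge 0$ and let $N_R=kp$ be a positive integer multiple of $p$. Let $R,S\in\mathbb{C}^{N_R\times N_R}$ be the submatrices of $(z-H)_{\mathrm{per}}$ in its first $N_R$ rows and, respectively, columns $N_b+1,\dots,N_b+N_R$ and columns $N_b+N_R+1,\dots,N_b+2N_R$,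 and assume that $R$ and $S$ together contain all the nonzero entries of $(z-H)_{\mathrm{per}}$ in its first $N_R$ rows. Then the matrix pencil $R+\lambda S$ is regular, i.e. $\lambda\mapsto\det(R+\lambda S)$ is not identically zero on $\mathbb{C}$. -/

import Mathlib

namespace EdgePencil

/-- The Hilbert space of square-summable complex sequences (sequences are indexed from `0`). -/
abbrev Ell2 : Type := lp (fun _ : ℕ => ℂ) 2

/-- The infinite matrix `H` is banded. -/
def IsBanded (H : Matrix ℕ ℕ ℂ) : Prop :=
  ∃ B : ℕ, 0 < B ∧ ∀ m n : ℕ, (B : ℤ) < |(m : ℤ) - (n : ℤ)| → H m n = 0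

/-- The infinite matrix `H` is eventually periodic with (positive) period `p`. -/
def IsEventuallyPeriodic (H : Matrix ℕ ℕ ℂ) (p : ℕ) : Prop :=
  0 < p ∧ ∃ M : ℕ, ∀ m : ℕ, M ≤ m → ∀ n : ℕ, H m n = H (m + p) (n + p)

theorem exists_entry_bound {H : Matrix ℕ ℕ ℂ} {p : ℕ} (hB : IsBanded H)
    (hP : IsEventuallyPeriodic H p) : ∃ C : ℝ, 0 ≤ C ∧ ∀ m n, ‖H m n‖ ≤ C := by
  obtain ⟨B, -, hB⟩ := hB
  obtain ⟨hp, M, hM⟩ := hP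
  set K := M + p + B + 1 with hK
  set C : ℝ := ∑ m ∈ Finset.range K, ∑ n ∈ Finset.range (K + B), ‖H m n‖ with hC
  have hC0 : 0 ≤ C := Finset.sum_nonneg fun _ _ => Finset.sum_nonneg fun _ _ => norm_nonneg _
  refine ⟨C, hC0, fun m => ?_⟩
  induction m using Nat.strong_induction_on with
  | _ m ih =>
    intro n
    by_cases hm : m < K
    · by_cases hn : n < K + B
      · have h1 : ‖H m n‖ ≤ ∑ n ∈ Finset.range (K + B), ‖H m n‖ :=
          Finset.single_le_sum (f := fun n => ‖H m n‖) (fun _ _ => norm_nonneg _)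
            (Finset.mem_range.2 hn)
        have h2 : ∑ n ∈ Finset.range (K + B), ‖H m n‖ ≤ C :=
          Finset.single_le_sum (f := fun m => ∑ n ∈ Finset.range (K + B), ‖H m n‖)
            (fun _ _ => Finset.sum_nonneg fun _ _ => norm_nonneg _) (Finset.mem_range.2 hm)
        exact h1.trans h2
      · have h0 : H m n = 0 := by
          apply hB
          rw [lt_abs]
          omega
        simpa [h0] using hC0
    · by_cases hn : n < p
      · have h0 : H m n = 0 := by
          apply hB
          rw [lt_abs]
          omega
        simpa [h0] using hC0
      · have h1 := hM (m - p) (by omega) (n - p)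
        rw [Nat.sub_add_cancel (by omega), Nat.sub_add_cancel (by omega)] at h1
        rw [← h1]
        exact ih (m - p) (by omega) (n - p)

theorem row_support {H : Matrix ℕ ℕ ℂ} {B : ℕ}
    (hB : ∀ m n : ℕ, (B : ℤ) < |(m : ℤ) - (n : ℤ)| → H m n = 0) (x : ℕ → ℂ) (m : ℕ) :
    ∀ n ∉ Finset.Icc (m - B) (m + B), H m n * x n = 0 := by
  intro n hn
  rw [hB m n, zero_mul]
  rw [Finset.mem_Icc] at hn
  rw [lt_abs]
  omega

/-- The Schur-type estimate behind boundedness of banded eventually periodic matrices. -/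
theorem exists_sum_bound {H : Matrix ℕ ℕ ℂ} {p : ℕ} (hB : IsBanded H)
    (hP : IsEventuallyPeriodic H p) :
    ∃ D : ℝ, 0 ≤ D ∧ ∀ (x : Ell2) (s : Finset ℕ),
      ∑ m ∈ s, ‖∑' n, H m n * x n‖ ^ (2 : ENNReal).toReal
        ≤ (D * ‖x‖) ^ (2 : ENNReal).toReal := by
  obtain ⟨C, hC0, hC⟩ := exists_entry_bound hB hP
  obtain ⟨B, -, hB⟩ := hB
  refine ⟨(2 * B + 1) * C, by positivity, fun x s => ?_⟩
  have hcard : ∀ m : ℕ, ((Finset.Icc (m - B) (m + B)).card : ℝ) ≤ 2 * B + 1 := by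
    intro m
    rw [Nat.card_Icc]
    have : m + B + 1 - (m - B) ≤ 2 * B + 1 := by omega
    exact_mod_cast this
  have hrow : ∀ m, ‖∑' n, H m n * x n‖ ^ 2 ≤
      (2 * B + 1) * C ^ 2 * ∑ n ∈ Finset.Icc (m - B) (m + B), ‖x n‖ ^ 2 := by
    intro m
    rw [tsum_eq_sum (row_support hB x m)]
    have h1 : ‖∑ n ∈ Finset.Icc (m - B) (m + B), H m n * x n‖ ≤
        C * ∑ n ∈ Finset.Icc (m - B) (m + B), ‖x n‖ := by
      rw [Finset.mul_sum]
      refine (norm_sum_le _ _).trans (Finset.sum_le_sum fun n _ => ?_)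
      rw [norm_mul]
      exact mul_le_mul_of_nonneg_right (hC m n) (norm_nonneg _)
    have h2 := sq_sum_le_card_mul_sum_sq (s := Finset.Icc (m - B) (m + B)) (f := fun n => ‖x n‖)
    have h3 : 0 ≤ ∑ n ∈ Finset.Icc (m - B) (m + B), ‖x n‖ ^ 2 :=
      Finset.sum_nonneg fun _ _ => by positivity
    calc ‖∑ n ∈ Finset.Icc (m - B) (m + B), H m n * x n‖ ^ 2
        ≤ (C * ∑ n ∈ Finset.Icc (m - B) (m + B), ‖x n‖) ^ 2 := by gcongr
      _ = C ^ 2 * (∑ n ∈ Finset.Icc (m - B) (m + B), ‖x n‖) ^ 2 := by ring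
      _ ≤ C ^ 2 * ((2 * B + 1) * ∑ n ∈ Finset.Icc (m - B) (m + B), ‖x n‖ ^ 2) := by
          gcongr
          exact h2.trans (mul_le_mul_of_nonneg_right (hcard m) h3)
      _ = _ := by ring
  have hsum : ∑ m ∈ s, ∑ n ∈ Finset.Icc (m - B) (m + B), ‖x n‖ ^ 2 ≤ (2 * B + 1) * ‖x‖ ^ 2 := by
    have hcomm : ∑ m ∈ s, ∑ n ∈ Finset.Icc (m - B) (m + B), ‖x n‖ ^ 2 =
        ∑ n ∈ s.biUnion (fun m => Finset.Icc (m - B) (m + B)),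
          ∑ m ∈ s.filter (fun m => n ∈ Finset.Icc (m - B) (m + B)), ‖x n‖ ^ 2 := by
      apply Finset.sum_comm'
      intro m n
      simp only [Finset.mem_biUnion, Finset.mem_filter]
      exact ⟨fun h => ⟨h, m, h⟩, fun h => h.1⟩
    have hx : ∑ n ∈ s.biUnion (fun m => Finset.Icc (m - B) (m + B)), ‖x n‖ ^ 2 ≤ ‖x‖ ^ 2 := by
      have := lp.sum_rpow_le_norm_rpow (p := 2) (by norm_num) x
        (s.biUnion (fun m => Finset.Icc (m - B) (m + B)))
      simpa using this
    rw [hcomm]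
    refine le_trans ?_ (mul_le_mul_of_nonneg_left hx (by positivity : (0 : ℝ) ≤ 2 * B + 1))
    rw [Finset.mul_sum]
    refine Finset.sum_le_sum fun n _ => ?_
    rw [Finset.sum_const, nsmul_eq_mul]
    refine mul_le_mul_of_nonneg_right (le_trans ?_ (hcard n)) (by positivity)
    refine Nat.cast_le.2 (Finset.card_le_card fun m hm => ?_)
    simp only [Finset.mem_filter, Finset.mem_Icc] at hm ⊢
    omega
  simp only [ENNReal.toReal_ofNat, Real.rpow_ofNat]
  calc ∑ m ∈ s, ‖∑' n, H m n * x n‖ ^ 2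
      ≤ ∑ m ∈ s, (2 * B + 1) * C ^ 2 * ∑ n ∈ Finset.Icc (m - B) (m + B), ‖x n‖ ^ 2 :=
        Finset.sum_le_sum fun m _ => hrow m
    _ = (2 * B + 1) * C ^ 2 * ∑ m ∈ s, ∑ n ∈ Finset.Icc (m - B) (m + B), ‖x n‖ ^ 2 := by
        rw [Finset.mul_sum]
    _ ≤ (2 * B + 1) * C ^ 2 * ((2 * B + 1) * ‖x‖ ^ 2) := by gcongr
    _ = _ := by ring

/-- The bounded operator on `ℓ²` given by a banded eventually periodic matrix:
`(H x) m = ∑ n, H m n * x n`, where each sum has finitely many nonzero terms. -/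
noncomputable def toOperator (H : Matrix ℕ ℕ ℂ) {p : ℕ} (hB : IsBanded H)
    (hP : IsEventuallyPeriodic H p) : Ell2 →L[ℂ] Ell2 :=
  LinearMap.mkContinuousOfExistsBound
    { toFun := fun x => ⟨fun m => ∑' n, H m n * x n, by
        obtain ⟨D, -, hD⟩ := exists_sum_bound hB hP
        exact memℓp_gen' (hD x)⟩
      map_add' := fun x y => by
        obtain ⟨B, -, hB'⟩ := hB
        ext m
        change ∑' n, H m n * (x n + y n) = ∑' n, H m n * x n + ∑' n, H m n * y n
        rw [tsum_eq_sum (row_support hB' x m), tsum_eq_sum (row_support hB' y m),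
          tsum_eq_sum (row_support hB' (fun n => x n + y n) m), ← Finset.sum_add_distrib]
        exact Finset.sum_congr rfl fun n _ => mul_add _ _ _
      map_smul' := fun a x => by
        ext m
        change ∑' n, H m n * (a * x n) = a * ∑' n, H m n * x n
        rw [← tsum_mul_left]
        exact tsum_congr fun n => by ring }
    (by
      obtain ⟨D, hD0, hD⟩ := exists_sum_bound hB hP
      exact ⟨D, fun x => lp.norm_le_of_forall_sum_le (by norm_num) (by positivity) (hD x)⟩)

theorem toOperator_apply (H : Matrix ℕ ℕ ℂ) {p : ℕ} (hB : IsBanded H)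
    (hP : IsEventuallyPeriodic H p) (x : Ell2) (m : ℕ) :
    toOperator H hB hP x m = ∑' n, H m n * x n := rfl

/-- The rows of `z - H` after the first `Nd` rows. -/
def lowerRows (H : Matrix ℕ ℕ ℂ) (z : ℂ) (Nd : ℕ) : Matrix ℕ ℕ ℂ :=
  (z • (1 : Matrix ℕ ℕ ℂ) - H).submatrix (fun i => Nd + i) id

/-- `A` consists of the `p × w` block `P` repeating off to infinity: the `k`-th copy occupies
the rows `k * p, …, k * p + p - 1` and the columns `c + k * p, …, c + k * p + w - 1`, and all
the other entries are zero. -/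
def IsPeriodicRepetition (A : Matrix ℕ ℕ ℂ) {p w : ℕ} (P : Matrix (Fin p) (Fin w) ℂ)
    (c : ℕ) : Prop :=
  ∀ (k : ℕ) (i : Fin p) (n : ℕ),
    A (k * p + i) n =
      if h : c + k * p ≤ n ∧ n - (c + k * p) < w then P i ⟨n - (c + k * p), h.2⟩ else 0

/-- The `q × q` submatrix of `A` in the top `q` rows and the `q` columns starting at `Nb`. -/
def blockR (A : Matrix ℕ ℕ ℂ) (Nb q : ℕ) : Matrix (Fin q) (Fin q) ℂ :=
  Matrix.of fun i j => A i (Nb + j)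

/-- The `q × q` submatrix of `A` immediately to the right of `blockR A Nb q`. -/
def blockS (A : Matrix ℕ ℕ ℂ) (Nb q : ℕ) : Matrix (Fin q) (Fin q) ℂ :=
  Matrix.of fun i j => A i (Nb + q + j)

/-- `blockR A Nb q` and `blockS A Nb q` together contain all the nonzero entries of `A` in the
rows they cover. -/
def BlocksContainRows (A : Matrix ℕ ℕ ℂ) (Nb q : ℕ) : Prop :=
  ∀ i n : ℕ, i < q → A i n ≠ 0 → Nb ≤ n ∧ n < Nb + 2 * q

/-- A square matrix pencil is regular if its determinant is not identically zero. -/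
def IsRegularPencil {q : ℕ} (L : ℂ → Matrix (Fin q) (Fin q) ℂ) : Prop :=
  ∃ μ : ℂ, (L μ).det ≠ 0

end EdgePencil

namespace EdgePencil

/-! If `det (R + μ S)` vanished for every `μ`, each `μ` would have a null vector `y ≠ 0`. For `‖μ‖ <
1` the blocks `y, μ y, μ² y, …`, placed from column `Nb` on, form an `ℓ²` sequence annihilated by
every row of `z - H` after the first `Nd` (`tsum_mul_geomSeq`). Taking `Nd + 1` distinct `μ` gives
independent vectors (`linearIndependent_geomSeq`) that `z - H` sends into an `Nd`-dimensional space,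
contradicting its injectivity (`not_linearIndependent_of_apply_eq_zero`). -/

/-- The sequence that vanishes below `Nb` and then consists of the blocks
`y, μ • y, μ ^ 2 • y, …` of length `q`. -/
noncomputable def geomSeq (Nb q : ℕ) [NeZero q] (μ : ℂ) (y : Fin q → ℂ) (n : ℕ) : ℂ :=
  if n < Nb then 0 else μ ^ ((n - Nb) / q) * y (Fin.ofNat q (n - Nb))

section geomSeq

variable (Nb q : ℕ) [NeZero q] (μ : ℂ) (y : Fin q → ℂ)

theorem geomSeq_block (j : ℕ) (l : Fin q) :
    geomSeq Nb q μ y (Nb + (j * q + l)) = μ ^ j * y l := by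
  have hq : 0 < q := Nat.pos_of_neZero q
  have h1 : (j * q + (l : ℕ)) / q = j := by
    rw [mul_comm, Nat.mul_add_div hq, Nat.div_eq_of_lt l.2, add_zero]
  have h2 : Fin.ofNat q (j * q + l) = l := by
    ext
    simp [Nat.mod_eq_of_lt l.2]
  rw [geomSeq, if_neg (by omega), Nat.add_sub_cancel_left, h1, h2]

theorem geomSeq_shift (n : ℕ) :
    geomSeq Nb q μ y (Nb + (n + q)) = μ * geomSeq Nb q μ y (Nb + n) := by
  have hq : 0 < q := Nat.pos_of_neZero q
  have hn : n = n / q * q + (⟨n % q, Nat.mod_lt _ hq⟩ : Fin q) := (Nat.div_add_mod' n q).symm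
  rw [show n + q = (n / q + 1) * q + (⟨n % q, Nat.mod_lt _ hq⟩ : Fin q) by
    rw [add_mul, one_mul]; omega, geomSeq_block]
  conv_rhs => rw [hn, geomSeq_block]
  ring

theorem memℓp_geomSeq (hμ : ‖μ‖ < 1) : Memℓp (geomSeq Nb q μ y) 2 := by
  have hq : 0 < q := Nat.pos_of_neZero q
  have hdiv : Summable fun x : ℕ × Fin q => ‖μ ^ x.1 * y x.2‖ ^ 2 := by
    have h : Summable fun j : ℕ => (‖μ‖ ^ 2) ^ j :=
      summable_geometric_of_lt_one (by positivity) (by nlinarith [norm_nonneg μ])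
    have h' : Summable fun l : Fin q => ‖y l‖ ^ 2 := (hasSum_fintype _).summable
    refine (h.mul_of_nonneg h' (fun _ => by positivity) (fun _ => by positivity)).congr
      fun x => ?_
    rw [norm_mul, norm_pow, mul_pow, ← pow_mul, ← pow_mul, mul_comm 2]
  have hsum : Summable fun n => ‖geomSeq Nb q μ y n‖ ^ 2 := by
    rw [← summable_nat_add_iff Nb, ← (Nat.divModEquiv q).symm.summable_iff]
    refine hdiv.congr fun x => ?_
    have : (Nat.divModEquiv q).symm x + Nb = Nb + (x.1 * q + x.2) := by
      simp [Nat.divModEquiv, add_comm, mul_comm]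
    simp only [Function.comp_apply, this, geomSeq_block]
  exact memℓp_gen (by simpa using hsum)

end geomSeq

/-- Sequences that are multiplied by distinct factors under the shift by `q` are linearly
independent. -/
theorem linearIndependent_geomSeq {ι : Type*} (Nb q : ℕ) [NeZero q] (μ : ι → ℂ)
    (hμ : Function.Injective μ) (y : ι → Fin q → ℂ) (hy : ∀ i, y i ≠ 0) :
    LinearIndependent ℂ fun i => (fun n => geomSeq Nb q (μ i) (y i) (Nb + n) : ℕ → ℂ) := by
  -- Once the zeros below `Nb` are dropped, each sequence is an eigenvector of the shift by `q`,
  -- with eigenvalue `μ i`.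
  refine Module.End.eigenvectors_linearIndependent' (LinearMap.funLeft ℂ ℂ (· + q)) μ hμ _
    fun i => ⟨Module.End.mem_eigenspace_iff.2 ?_, fun h => hy i ?_⟩
  · ext n
    exact geomSeq_shift Nb q (μ i) (y i) n
  · ext l
    simpa using (geomSeq_block Nb q (μ i) (y i) 0 l).symm.trans (congrFun h _)

theorem IsPeriodicRepetition.apply_add {A : Matrix ℕ ℕ ℂ} {p w c : ℕ}
    {P : Matrix (Fin p) (Fin w) ℂ} (hp : 0 < p) (h : IsPeriodicRepetition A P c) (j i n : ℕ) :
    A (j * p + i) (j * p + n) = A i n := by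
  have hi : i = i / p * p + (⟨i % p, Nat.mod_lt _ hp⟩ : Fin p) := (Nat.div_add_mod' i p).symm
  conv_rhs => rw [hi, h]
  rw [show j * p + i = (j + i / p) * p + (⟨i % p, Nat.mod_lt _ hp⟩ : Fin p) by
    rw [add_mul]; omega, h]
  have e : j * p + n - (c + (j + i / p) * p) = n - (c + i / p * p) := by rw [add_mul]; omega
  have e' : c + (j + i / p) * p ≤ j * p + n ↔ c + i / p * p ≤ n := by rw [add_mul]; omega
  simp only [e, e']

/-- Complements `apply_add`, which says nothing about columns to the left of `j * p`: the copy of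
`P` in these rows starts at column `c + j * p` or later. -/
theorem IsPeriodicRepetition.apply_eq_zero {A : Matrix ℕ ℕ ℂ} {p w c : ℕ}
    {P : Matrix (Fin p) (Fin w) ℂ} (hp : 0 < p) (h : IsPeriodicRepetition A P c) {j i n : ℕ}
    (hn : n < j * p) : A (j * p + i) n = 0 := by
  rw [show j * p + i = (j + i / p) * p + (⟨i % p, Nat.mod_lt _ hp⟩ : Fin p) by
    rw [add_mul]; have := Nat.div_add_mod' i p; dsimp only; omega, h, dif_neg]
  rw [add_mul]
  omega

/-- A periodic matrix acts on a geometric block sequence through its pencil. -/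
theorem tsum_mul_geomSeq {A : Matrix ℕ ℕ ℂ} {Nb q : ℕ} [NeZero q]
    (hA : ∀ j i n, A (j * q + i) (j * q + n) = A i n)
    (hA0 : ∀ j i n, n < j * q → A (j * q + i) n = 0)
    (hRS : BlocksContainRows A Nb q) (μ : ℂ) (y : Fin q → ℂ) (j : ℕ) (i : Fin q) :
    ∑' n, A (j * q + i) n * geomSeq Nb q μ y n =
      μ ^ j * ((blockR A Nb q + μ • blockS A Nb q).mulVec y) i := by
  -- Shifted by `j` blocks, the row meets only column blocks `j` and `j + 1` counted from `Nb`.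
  -- There `R` acts on `μ ^ j • y` and `S` on `μ ^ (j + 1) • y`.
  have hsupp : Function.support (fun n => A (j * q + i) n * geomSeq Nb q μ y n) ⊆
      Set.range (Sum.elim (fun l : Fin q => Nb + (j * q + l))
        fun l : Fin q => Nb + ((j + 1) * q + l)) := by
    intro n hn
    have hn : A (j * q + i) n ≠ 0 := left_ne_zero_of_mul hn
    have hle : j * q ≤ n := not_lt.1 fun h => hn (hA0 j i n h)
    obtain ⟨m, rfl⟩ := Nat.exists_eq_add_of_le hle
    rw [hA] at hn
    obtain ⟨h1, h2⟩ := hRS i m i.2 hn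
    by_cases hm : m < Nb + q
    · exact ⟨Sum.inl ⟨m - Nb, by omega⟩, by simp; omega⟩
    · exact ⟨Sum.inr ⟨m - Nb - q, by omega⟩, by simp [add_mul]; omega⟩
  have hinj : Function.Injective (Sum.elim (fun l : Fin q => Nb + (j * q + l))
      fun l : Fin q => Nb + ((j + 1) * q + l)) := by
    rintro (l | l) (l' | l') h <;> simp [add_mul] at h <;> (congr; omega)
  rw [← hinj.tsum_eq hsupp, tsum_fintype, Fintype.sum_sum_type]
  simp only [Sum.elim_inl, Sum.elim_inr, geomSeq_block, Matrix.mulVec, dotProduct,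
    Matrix.add_apply, Matrix.smul_apply, blockR, blockS, Matrix.of_apply, smul_eq_mul]
  rw [← Finset.sum_add_distrib, Finset.mul_sum]
  refine Finset.sum_congr rfl fun l _ => ?_
  rw [show Nb + (j * q + (l : ℕ)) = j * q + (Nb + l) by omega,
    show Nb + ((j + 1) * q + (l : ℕ)) = j * q + (Nb + q + l) by rw [add_mul]; omega, hA, hA]
  ring

theorem sub_toOperator_apply_add (H : Matrix ℕ ℕ ℂ) {p : ℕ} (hB : IsBanded H)
    (hP : IsEventuallyPeriodic H p) (z : ℂ) (Nd : ℕ) (x : Ell2) (i : ℕ) :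
    (algebraMap ℂ (Ell2 →L[ℂ] Ell2) z - toOperator H hB hP) x (Nd + i) =
      ∑' n, lowerRows H z Nd i n * x n := by
  have h1 : (algebraMap ℂ (Ell2 →L[ℂ] Ell2) z - toOperator H hB hP) x (Nd + i) =
      z * x (Nd + i) - ∑' n, H (Nd + i) n * x n := by
    rw [← toOperator_apply H hB hP]
    rw [Algebra.algebraMap_eq_smul_one]
    rfl
  obtain ⟨B, -, hB'⟩ := id hB
  have hH : Summable fun n => H (Nd + i) n * x n :=
    summable_of_ne_finset_zero (row_support hB' x (Nd + i))
  have hz : HasSum (fun n => (z • (1 : Matrix ℕ ℕ ℂ)) (Nd + i) n * x n) (z * x (Nd + i)) := by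
    convert hasSum_single (Nd + i) fun n hn => ?_ using 1
    · simp
    · simp [Matrix.one_apply_ne hn.symm]
  rw [h1, ← (hz.sub hH.hasSum).tsum_eq]
  exact tsum_congr fun n => by simp [lowerRows, sub_mul]

/-- An injective linear map on `ℓ²` cannot send more than `N` linearly independent vectors to
sequences supported in the first `N` coordinates. -/
theorem not_linearIndependent_of_apply_eq_zero {T : Ell2 →L[ℂ] Ell2}
    (hT : Function.Injective T) {N : ℕ} (v : Fin (N + 1) → Ell2)
    (hv : ∀ i n, T (v i) (N + n) = 0) : ¬ LinearIndependent ℂ v := by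
  intro hli
  let f : (Fin (N + 1) → ℂ) →ₗ[ℂ] Ell2 := T.toLinearMap ∘ₗ Fintype.linearCombination ℂ v
  have hf : ∀ a n, f a (N + n) = 0 := fun a n => by
    have h : f a = ∑ i, a i • T (v i) := by simp [f, Fintype.linearCombination_apply]
    rw [h, lp.coeFn_sum]
    refine (Finset.sum_apply _ _ _).trans (Finset.sum_eq_zero fun i _ => ?_)
    change a i * T (v i) (N + n) = 0
    rw [hv, mul_zero]
  -- Keep the only coordinates of `f a` that can be nonzero; a map from dimension `N + 1` to `N` has
  -- a kernel.
  let g : (Fin (N + 1) → ℂ) →ₗ[ℂ] (Fin N → ℂ) :=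
    { toFun := fun a l => f a l
      map_add' := fun a b => by ext l; simp
      map_smul' := fun a b => by ext l; simp }
  obtain ⟨a, ha, ha0⟩ := (Submodule.ne_bot_iff _).1
    (LinearMap.ker_ne_bot_of_finrank_lt (f := g) (by simp))
  have hfa : f a = 0 := by
    ext n
    by_cases hn : n < N
    · exact congrFun (LinearMap.mem_ker.1 ha) ⟨n, hn⟩
    · obtain ⟨m, rfl⟩ := Nat.exists_eq_add_of_le (not_lt.1 hn)
      exact hf a m
  have hla : Fintype.linearCombination ℂ v a = 0 := hT (hfa.trans (map_zero T).symm)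
  exact ha0 (funext (Fintype.linearIndependent_iff.1 hli a hla))

end EdgePencil

open EdgePencil in
theorem mainTheorem5 (H : Matrix ℕ ℕ ℂ) (p : ℕ)
    (hB : EdgePencil.IsBanded H) (hP : EdgePencil.IsEventuallyPeriodic H p)
    (z : ℂ) (hz : z ∉ spectrum ℂ (EdgePencil.toOperator H hB hP))
    (Nd w c : ℕ) (P : Matrix (Fin p) (Fin w) ℂ)
    (hper : EdgePencil.IsPeriodicRepetition (EdgePencil.lowerRows H z Nd) P c)
    (Nb k : ℕ) (hk : 0 < k)
    (hRS : EdgePencil.BlocksContainRows (EdgePencil.lowerRows H z Nd) Nb (k * p)) :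
    EdgePencil.IsRegularPencil (fun μ : ℂ =>
      EdgePencil.blockR (EdgePencil.lowerRows H z Nd) Nb (k * p) +
        μ • EdgePencil.blockS (EdgePencil.lowerRows H z Nd) Nb (k * p)) := by
  have hp : 0 < p := hP.1
  have hA := hper.apply_add hp
  have hA0 : ∀ j i n, n < j * p → lowerRows H z Nd (j * p + i) n = 0 :=
    fun _ _ _ => hper.apply_eq_zero hp
  have hAq : ∀ j i n, lowerRows H z Nd (j * (k * p) + i) (j * (k * p) + n) =
      lowerRows H z Nd i n := fun j i n => by rw [← mul_assoc, hA]
  have hAq0 : ∀ j i n, n < j * (k * p) → lowerRows H z Nd (j * (k * p) + i) n = 0 :=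
    fun j i n hn => by rw [← mul_assoc] at hn ⊢; exact hA0 _ _ _ hn
  have hq : 0 < k * p := Nat.mul_pos hk hp
  generalize k * p = q at *
  have : NeZero q := ⟨hq.ne'⟩
  by_contra hreg
  simp only [IsRegularPencil, not_exists, not_not] at hreg
  choose y hy0 hy using fun μ => Matrix.exists_mulVec_eq_zero_iff.2 (hreg μ)
  -- Any `Nd + 1` distinct points of the open unit disc would do.
  let μ : Fin (Nd + 1) → ℂ := fun i => ((i : ℂ) + 2)⁻¹
  have hμinj : Function.Injective μ := fun a b h => by
    have h' : (a : ℂ) = b := by simpa [μ] using h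
    exact Fin.ext (by exact_mod_cast h')
  have hμ : ∀ i, ‖μ i‖ < 1 := fun i => by
    have h : ‖((i : ℕ) : ℂ) + 2‖ = (i : ℕ) + 2 := by
      exact_mod_cast Complex.norm_natCast ((i : ℕ) + 2)
    rw [norm_inv, h]
    exact inv_lt_one_of_one_lt₀ (by have : (0 : ℝ) ≤ (i : ℕ) := Nat.cast_nonneg _; linarith)
  let v : Fin (Nd + 1) → Ell2 :=
    fun i => ⟨geomSeq Nb q (μ i) (y (μ i)), memℓp_geomSeq Nb q (μ i) (y (μ i)) (hμ i)⟩
  have hT : Function.Injective (algebraMap ℂ (Ell2 →L[ℂ] Ell2) z - toOperator H hB hP) :=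
    (ContinuousLinearMap.isUnit_iff_bijective.1 (spectrum.notMem_iff.1 hz)).1
  refine not_linearIndependent_of_apply_eq_zero hT v (fun i n => ?_) ?_
  · rw [sub_toOperator_apply_add]
    -- Row `n` below the first `Nd` is row `n % q` of the row block `n / q`.
    have h := tsum_mul_geomSeq hAq hAq0 hRS (μ i) (y (μ i)) (n / q) ⟨n % q, Nat.mod_lt _ hq⟩
    rw [hy, Pi.zero_apply, mul_zero] at h
    simpa only [Nat.div_add_mod'] using h
  -- Independence may be checked after forgetting the first `Nb` entries.
  · let e : Ell2 →ₗ[ℂ] (ℕ → ℂ) :=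
      { toFun := fun x n => x (Nb + n)
        map_add' := fun a b => by ext l; simp
        map_smul' := fun a b => by ext l; simp }
    exact LinearIndependent.of_comp e
      (linearIndependent_geomSeq Nb q μ hμinj (fun i => y (μ i)) fun i => hy0 (μ i))
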